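/- Fix $\varepsilon\in(0,1)$. There is a constant $c=c(\varepsilon)>0$ such that the following holds for every $\alpha\in(1,2)$ and every positive integer $n$ with $(1-\varepsilon)n>1$ (automatic if $\varepsilon<3/4$). Put $m=2\lceil n^{2-\alpha}\rceil$ and assume that $m$ divides $n$. Take the cycle on $\mathbb{Z}/n$ and add, as long range edges, the edges of any matching (perfect or not) on the $m$ exactly equidistant nodes $0,\ n/m,\ 2n/m,\dots,(m-1)n/m$; thus the bound holds for every realization of the random matching. For real parameters $q_c,q_l,r,d$ with $d>0$, let $P$ be the homogeneous chain on this graph: from each node it moves clockwise along the cycle with probability $q_c+r$, counterclockwise with probability $q_c-r$, along a long range edge at the node (if there is one) with probability $q_l/d$, and otherwise stays put (the probabilities are added if a long range edge coincides with a cycle edge). Assume that the parameters are such that $P$ is a stochastic matrix (no reversibility, i.e. $r=0$, is required) and that $P$ has a unique stationary distribution $\pi$. Then $$c\,n^{2\alpha-2}\le t_{\rm mix}(P,\varepsilon),\qquad t_{\rm mix}(P,\varepsilon)=\max_{\sigma}\min\{k\ge 0:\|\sigma P^k-\pi\|_{\rm TV}\le\varepsilon\},$$ where $\sigma$ ranges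 over all probability distributions on the nodes, $\|\mu-\nu\|_{\rm TV}=\max_A|\mu(A)-\nu(A)|$, and the minimum of the empty set is $+\infty$. The constant $c$ does not depend on $\alpha$, $n$, the matching, or $q_c,q_l,r,d$. -/

import Mathlib

open scoped ENNReal Matrix

noncomputable section

/-- Total variation distance `max_A |μ(A) - ν(A)|` of two weight vectors on a finite set
(the supremum runs over the finitely many subsets, so it is a maximum). -/
def tvDist {X : Type*} (μ ν : X → ℝ) : ℝ :=
  ⨆ A : Finset X, |∑ x ∈ A, μ x - ∑ x ∈ A, ν x|

/-- `π` is a probability distribution with `π P = π`. -/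
def IsStationaryDist {X : Type*} [Fintype X] (P : Matrix X X ℝ) (π : X → ℝ) : Prop :=
  π ∈ stdSimplex ℝ X ∧ π ᵥ* P = π

/-- The mixing time `max_σ min {k : ‖σ P^k - π‖_TV ≤ ε}` over all starting distributions `σ`,
with `min ∅ = ∞`. -/
def mixingTime {X : Type*} [Fintype X] [DecidableEq X]
    (P : Matrix X X ℝ) (π : X → ℝ) (ε : ℝ) : ℕ∞ :=
  ⨆ σ ∈ stdSimplex ℝ X, ⨅ k ∈ {k : ℕ | tvDist (σ ᵥ* P ^ k) π ≤ ε}, (k : ℕ∞)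

open Classical in
/-- Transition matrix of the homogeneous chain on the cycle `ℤ/n` with graph `G` of long range
edges: clockwise steps `qc + r`, counterclockwise steps `qc - r`, probability `ql / d` for each
long range edge at the current node, and the remaining mass on staying put. -/
def homogeneousMatrix {n : ℕ} [NeZero n] (G : SimpleGraph (ZMod n)) (qc ql r d : ℝ) :
    Matrix (ZMod n) (ZMod n) ℝ :=
  fun x y =>
    (if y = x + 1 then qc + r else 0)
    + (if y = x - 1 then qc - r else 0)
    + (if G.Adj x y then ql / d else 0)
    + (if y = x then 1 - 2 * qc - ∑ z, (if G.Adj x z then ql / d else 0) else 0)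

/-- The `m` nodes `0, n/m, 2n/m, …, (m-1)n/m` of the cycle `ℤ/n` (used when `m ∣ n`). -/
def equidistantNodes (n m : ℕ) : Set (ZMod n) :=
  {x | ∃ i < m, x = ((i * (n / m) : ℕ) : ZMod n)}

end

/-! ### Total variation and mixing time -/

open Finset

/-! Let `l = n / m`. The character `x ↦ exp (2πi x / l)` equals 1 on all equidistant nodes, so it
does not see the long range edges and is an eigenfunction of the chain, with the eigenvalue `z` of a
lazy biased walk. Here `‖z‖ ^ 2 ≥ 1 - (2π / l) ^ 2`, so `‖z‖ ^ (2 * k)` stays near 1 while `k` is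
small against `l ^ 2`, and `l ^ 2` is at least of order `n ^ (2 * α - 2)`.

For the chain started at `x`, the character at time `k` has mean `z ^ k * f x` and variance `1 - ‖z‖
^ (2 * k)`, hence concentrates near its mean (`one_sub_le_sum_ball`). From `J` starting points with
separated character values the resulting balls are disjoint, so `π` gives one of them mass at most
`1 / J`, while the chain from that point is mostly inside (`exists_lt_tvDist_of_eigenfunction`).
Choosing `J` large reaches every `ε < 1`; only moduli enter, so reversibility is irrelevant. -/

lemma abs_sum_sub_le_tvDist {X : Type*} [Finite X] (μ ν : X → ℝ) (A : Finset X) :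
    |∑ x ∈ A, μ x - ∑ x ∈ A, ν x| ≤ tvDist μ ν :=
  le_ciSup (f := fun A : Finset X => |∑ x ∈ A, μ x - ∑ x ∈ A, ν x|)
    (Set.finite_range _).bddAbove A

/-- Testing against a `[0, 1]`-valued function is controlled by the total variation distance. -/
lemma abs_sum_mul_le_tvDist {X : Type*} [Fintype X] (μ ν g : X → ℝ)
    (hg0 : ∀ x, 0 ≤ g x) (hg1 : ∀ x, g x ≤ 1) :
    |∑ x, (μ x - ν x) * g x| ≤ tvDist μ ν := by
  classical
  -- The extremal tests are the indicators of the sets where `μ - ν` has constant sign.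
  have h1 := abs_sum_sub_le_tvDist μ ν {x | 0 ≤ μ x - ν x}
  have h2 := abs_sum_sub_le_tvDist μ ν {x | μ x - ν x ≤ 0}
  rw [← sum_sub_distrib, sum_filter] at h1 h2
  refine abs_le.2 ⟨le_trans (abs_le.1 h2).1 (sum_le_sum fun x _ => ?_),
    le_trans (sum_le_sum fun x _ => ?_) (abs_le.1 h1).2⟩
  · have := hg0 x
    have := hg1 x
    split_ifs <;> nlinarith
  · have := hg0 x
    have := hg1 x
    split_ifs <;> nlinarith

lemma tvDist_vecMul_le {X : Type*} [Fintype X] [DecidableEq X] {P : Matrix X X ℝ}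
    (hP : P ∈ Matrix.rowStochastic ℝ X) (μ ν : X → ℝ) :
    tvDist (μ ᵥ* P) (ν ᵥ* P) ≤ tvDist μ ν := by
  have hP' := Matrix.mem_rowStochastic_iff_sum.1 hP
  refine ciSup_le fun A => ?_
  have key : ∑ x ∈ A, (μ ᵥ* P) x - ∑ x ∈ A, (ν ᵥ* P) x =
      ∑ x, (μ x - ν x) * ∑ y ∈ A, P x y := by
    simp only [Matrix.vecMul, dotProduct]
    rw [sum_comm, sum_comm (s := A), ← sum_sub_distrib]
    refine sum_congr rfl fun x _ => ?_
    rw [← mul_sum, ← mul_sum, sub_mul]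
  rw [key]
  refine abs_sum_mul_le_tvDist μ ν _ (fun x => sum_nonneg fun y _ => hP'.1 x y) fun x => ?_
  rw [← hP'.2 x]
  exact sum_le_sum_of_subset_of_nonneg (subset_univ A) fun y _ _ => hP'.1 x y

lemma tvDist_vecMul_pow_anti {X : Type*} [Fintype X] [DecidableEq X] {P : Matrix X X ℝ}
    (hP : P ∈ Matrix.rowStochastic ℝ X) {π : X → ℝ} (hπ : π ᵥ* P = π) (σ : X → ℝ) :
    Antitone fun k : ℕ => tvDist (σ ᵥ* P ^ k) π := by
  refine antitone_nat_of_succ_le fun k => ?_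
  have h := tvDist_vecMul_le hP (σ ᵥ* P ^ k) π
  rwa [hπ, Matrix.vecMul_vecMul, ← pow_succ] at h

lemma natCast_succ_le_mixingTime {X : Type*} [Fintype X] [DecidableEq X] {P : Matrix X X ℝ}
    (hP : P ∈ Matrix.rowStochastic ℝ X) {π : X → ℝ} (hπ : π ᵥ* P = π) {σ : X → ℝ}
    (hσ : σ ∈ stdSimplex ℝ X) {ε : ℝ} {k : ℕ} (h : ε < tvDist (σ ᵥ* P ^ k) π) :
    ((k + 1 : ℕ) : ℕ∞) ≤ mixingTime P π ε := by
  refine le_iSup₂_of_le σ hσ (le_iInf₂ fun j hj => ?_)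
  rw [Nat.cast_le]
  by_contra hlt
  exact absurd (h.trans_le (tvDist_vecMul_pow_anti hP hπ σ (by omega : j ≤ k))) (not_lt.2 hj)

/-- It suffices that at every time before `T` some starting distribution is not mixed. -/
lemma ofReal_le_mixingTime {X : Type*} [Fintype X] [DecidableEq X] {P : Matrix X X ℝ}
    (hP : P ∈ Matrix.rowStochastic ℝ X) {π : X → ℝ} (hπ : π ᵥ* P = π) {ε T : ℝ}
    (h : ∀ k : ℕ, (k : ℝ) < T → ∃ σ ∈ stdSimplex ℝ X, ε < tvDist (σ ᵥ* P ^ k) π) :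
    ENNReal.ofReal T ≤ ((mixingTime P π ε : ℕ∞) : ℝ≥0∞) := by
  rcases le_or_gt T 0 with hT | hT
  · simp [ENNReal.ofReal_of_nonpos hT]
  have hc : 0 < ⌈T⌉₊ := Nat.ceil_pos.2 hT
  obtain ⟨σ, hσ, hlt⟩ := h (⌈T⌉₊ - 1) (Nat.lt_ceil.1 (by omega))
  have h1 := natCast_succ_le_mixingTime hP hπ hσ hlt
  rw [Nat.sub_add_cancel hc] at h1
  calc ENNReal.ofReal T ≤ ENNReal.ofReal (⌈T⌉₊ : ℝ) := ENNReal.ofReal_le_ofReal (Nat.le_ceil T)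
    _ = ((⌈T⌉₊ : ℕ∞) : ℝ≥0∞) := by simp
    _ ≤ _ := by exact_mod_cast h1

lemma exists_lt_tvDist_single {X : Type*} [Fintype X] [DecidableEq X] {π : X → ℝ}
    (hπ : π ∈ stdSimplex ℝ X) {ε : ℝ} (h : 1 < (1 - ε) * Fintype.card X) :
    ∃ σ ∈ stdSimplex ℝ X, ε < tvDist σ π := by
  obtain ⟨x, hx⟩ : ∃ x, π x < 1 - ε := by
    by_contra! hall
    have h1 := card_nsmul_le_sum univ π (1 - ε) fun x _ => hall x
    rw [hπ.2, nsmul_eq_mul, card_univ] at h1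
    linarith
  refine ⟨Pi.single x 1, single_mem_stdSimplex ℝ x, ?_⟩
  have h1 := abs_sum_sub_le_tvDist (Pi.single x 1) π {x}
  rw [sum_singleton, sum_singleton, Pi.single_eq_same] at h1
  linarith [le_abs_self (1 - π x)]

/-! ### Concentration of a unimodular eigenfunction -/

/-- Chebyshev's inequality for a unimodular function with mean `v`. -/
lemma one_sub_le_sum_ball {X : Type*} [Fintype X] {μ : X → ℝ} (hμ : μ ∈ stdSimplex ℝ X)
    {f : X → ℂ} (hf : ∀ x, ‖f x‖ = 1) {v : ℂ} (hv : ∑ x, (μ x : ℂ) * f x = v)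
    {ρ : ℝ} (hρ : 0 < ρ) :
    1 - (1 - ‖v‖ ^ 2) / ρ ^ 2 ≤ ∑ x with ‖f x - v‖ < ρ, μ x := by
  have hvar : ∑ x, μ x * ‖f x - v‖ ^ 2 = 1 - ‖v‖ ^ 2 := by
    have hre : ∑ x, μ x * (f x).re = v.re := by
      rw [← hv, Complex.re_sum]; simp
    have him : ∑ x, μ x * (f x).im = v.im := by
      rw [← hv, Complex.im_sum]; simp
    have hx : ∀ x, μ x * ‖f x - v‖ ^ 2 = μ x * (1 + ‖v‖ ^ 2)
        - 2 * v.re * (μ x * (f x).re) - 2 * v.im * (μ x * (f x).im) := by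
      intro x
      have h1 : ‖f x‖ ^ 2 = 1 := by rw [hf, one_pow]
      rw [Complex.sq_norm, Complex.normSq_apply] at h1 ⊢
      rw [Complex.sq_norm, Complex.normSq_apply, Complex.sub_re, Complex.sub_im]
      linear_combination μ x * h1
    simp_rw [hx]
    rw [sum_sub_distrib, sum_sub_distrib, ← sum_mul, ← mul_sum, ← mul_sum, hre, him, hμ.2,
      Complex.sq_norm, Complex.normSq_apply]
    ring
  rw [sub_le_iff_le_add, ← sub_le_iff_le_add', le_div_iff₀ (by positivity), ← hvar, ← hμ.2,
    ← sum_filter_add_sum_filter_not univ (fun x => ‖f x - v‖ < ρ) μ, add_sub_cancel_left,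
    sum_mul]
  calc _ ≤ ∑ x with ¬ ‖f x - v‖ < ρ, μ x * ‖f x - v‖ ^ 2 := by
        refine sum_le_sum fun x hx => ?_
        have hx' : ρ ≤ ‖f x - v‖ := not_lt.1 (mem_filter.1 hx).2
        have := hμ.1 x
        gcongr
    _ ≤ _ := sum_le_sum_of_subset_of_nonneg (filter_subset _ _) fun x _ _ =>
        mul_nonneg (hμ.1 x) (by positivity)

lemma exists_sum_le_of_disjoint {X : Type*} [Fintype X] [DecidableEq X] {π : X → ℝ}
    (hπ : π ∈ stdSimplex ℝ X) {J : ℕ} (hJ : 0 < J) (A : ℕ → Finset X)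
    (hA : ∀ i < J, ∀ j < J, i ≠ j → Disjoint (A i) (A j)) :
    ∃ j < J, ∑ x ∈ A j, π x ≤ 1 / J := by
  by_contra! hall
  have h1 : ∑ j ∈ range J, ∑ x ∈ A j, π x ≤ 1 := by
    rw [← sum_biUnion fun i hi j hj hij => hA i (by simpa using hi) j (by simpa using hj) hij,
      ← hπ.2]
    exact sum_le_sum_of_subset_of_nonneg (subset_univ _) fun x _ _ => hπ.1 x
  have h2 : ∑ _j ∈ range J, (1 / J : ℝ) < ∑ j ∈ range J, ∑ x ∈ A j, π x :=
    sum_lt_sum_of_nonempty (nonempty_range_iff.2 hJ.ne') fun j hj => hall j (mem_range.1 hj)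
  have hJ' : (J : ℝ) ≠ 0 := by exact_mod_cast hJ.ne'
  rw [sum_const, card_range, nsmul_eq_mul, mul_one_div_cancel hJ'] at h2
  linarith

lemma sum_pow_mul_eigenfunction {X : Type*} [Fintype X] [DecidableEq X] {P : Matrix X X ℝ}
    {f : X → ℂ} {z : ℂ} (hPf : ∀ x, ∑ y, (P x y : ℂ) * f y = z * f x) (k : ℕ) (x : X) :
    ∑ y, ((P ^ k) x y : ℂ) * f y = z ^ k * f x := by
  induction k generalizing x with
  | zero => simp [Matrix.one_apply, apply_ite Complex.ofReal]
  | succ k ih =>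
    simp_rw [pow_succ' P, Matrix.mul_apply, Complex.ofReal_sum, sum_mul]
    rw [sum_comm]
    simp_rw [Complex.ofReal_mul, mul_assoc, ← mul_sum, ih, mul_left_comm _ (z ^ k), ← mul_sum,
      hPf]
    ring

/-- An eigenfunction of modulus one separating `J` points by `2 / J` keeps the chain unmixed. -/
lemma exists_lt_tvDist_of_eigenfunction {X : Type*} [Fintype X] [DecidableEq X]
    {P : Matrix X X ℝ} (hP : P ∈ Matrix.rowStochastic ℝ X) {π : X → ℝ} (hπ : π ∈ stdSimplex ℝ X)
    {f : X → ℂ} (hf : ∀ x, ‖f x‖ = 1) {z : ℂ} (hPf : ∀ x, ∑ y, (P x y : ℂ) * f y = z * f x)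
    {J : ℕ} (hJ : 0 < J) (p : ℕ → X)
    (hsep : ∀ i < J, ∀ j < J, i ≠ j → 2 / (J : ℝ) ≤ ‖f (p i) - f (p j)‖)
    {ε δ : ℝ} {k : ℕ} (hk : 1 - δ ≤ ‖z‖ ^ (2 * k)) (hδ : δ ≤ 3 / 4)
    (hε : ε < 1 - 4 * J ^ 2 * δ - 1 / J) :
    ∃ σ ∈ stdSimplex ℝ X, ε < tvDist (σ ᵥ* P ^ k) π := by
  have hJ' : (0 : ℝ) < J := by exact_mod_cast hJ
  -- Multiplication by `z ^ k` at most halves the separation `2 / J`, so balls of radius `1 / (2 *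
  -- J)` around the means are disjoint.
  have hz : 1 / 2 ≤ ‖z‖ ^ k := by
    rw [mul_comm, pow_mul] at hk
    have : 0 ≤ ‖z‖ ^ k := by positivity
    nlinarith
  obtain ⟨j, hj, hle⟩ := exists_sum_le_of_disjoint hπ hJ
    (fun j => ({y | ‖f y - z ^ k * f (p j)‖ < 1 / (2 * J)} : Finset X)) (by
      intro i hi j hj hij
      rw [disjoint_filter]
      intro y _ h1 h2
      have h3 := hsep i hi j hj hij
      have h4 : ‖z ^ k * f (p i) - z ^ k * f (p j)‖ < 1 / (2 * J) + 1 / (2 * J) := by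
        refine lt_of_le_of_lt ?_ (add_lt_add h1 h2)
        rw [norm_sub_rev (f y)]
        exact norm_sub_le_norm_sub_add_norm_sub _ _ _
      rw [← mul_sub, norm_mul, norm_pow] at h4
      have h5 : 1 / 2 * (2 / (J : ℝ)) ≤ ‖z‖ ^ k * ‖f (p i) - f (p j)‖ := by gcongr
      have h6 : 1 / (2 * (J : ℝ)) + 1 / (2 * J) = 1 / 2 * (2 / (J : ℝ)) := by field_simp; norm_num
      linarith)
  refine ⟨Pi.single (p j) 1, single_mem_stdSimplex ℝ _, ?_⟩
  have hPk := Matrix.mem_rowStochastic_iff_sum.1 (pow_mem hP k)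
  have hrow : Pi.single (p j) 1 ᵥ* P ^ k = (P ^ k) (p j) := by
    rw [Matrix.single_one_vecMul]; rfl
  rw [hrow]
  have h1 := one_sub_le_sum_ball (μ := (P ^ k) (p j)) ⟨hPk.1 _, hPk.2 _⟩ hf
    (sum_pow_mul_eigenfunction hPf k (p j)) (ρ := 1 / (2 * J)) (by positivity)
  have h2 := abs_sum_sub_le_tvDist ((P ^ k) (p j)) π {y | ‖f y - z ^ k * f (p j)‖ < 1 / (2 * J)}
  have h3 := (le_abs_self _).trans h2
  have h4 : (1 - ‖z ^ k * f (p j)‖ ^ 2) / (1 / (2 * (J : ℝ))) ^ 2 ≤ 4 * J ^ 2 * δ := by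
    rw [norm_mul, hf, mul_one, norm_pow, ← pow_mul, mul_comm k, one_div, inv_pow, div_inv_eq_mul]
    have : 0 < (J : ℝ) ^ 2 := by positivity
    nlinarith
  linarith

/-! ### The character of the cycle and its eigenvalue -/

/-- The additive character `x ↦ exp (2 π i m x / n)` of `ℤ/n`. -/
noncomputable def cycleChar (n m : ℕ) [NeZero n] (x : ZMod n) : ℂ := ZMod.stdAddChar ((m : ZMod n) * x)

/-- The eigenvalue of the lazy biased walk belonging to the character. -/
noncomputable def cycleEigenvalue (n m : ℕ) (qc r : ℝ) : ℂ :=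
  (1 - 2 * qc * (1 - Real.cos (2 * Real.pi * m / n)) : ℝ) +
    (2 * r * Real.sin (2 * Real.pi * m / n) : ℝ) * Complex.I

section cycleChar

variable {n m : ℕ} [NeZero n]

lemma cycleChar_add (x y : ZMod n) : cycleChar n m (x + y) = cycleChar n m x * cycleChar n m y := by
  rw [cycleChar, mul_add, AddChar.map_add_eq_mul]; rfl

lemma norm_cycleChar (x : ZMod n) : ‖cycleChar n m x‖ = 1 := AddChar.norm_apply _ _

lemma cycleChar_intCast (a : ℤ) :
    cycleChar n m a = Complex.exp (Complex.I * ((2 * Real.pi * m / n * a : ℝ) : ℂ)) := by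
  have h := ZMod.stdAddChar_coe (N := n) ((m : ℤ) * a)
  push_cast at h
  rw [cycleChar, h]
  push_cast
  ring_nf

lemma cycleChar_eq_one_of_mem (hmn : m ∣ n) {x : ZMod n} (hx : x ∈ equidistantNodes n m) :
    cycleChar n m x = 1 := by
  obtain ⟨i, -, rfl⟩ := hx
  have h : (m : ZMod n) * ((i * (n / m) : ℕ) : ZMod n) = 0 := by
    rw [← Nat.cast_mul, mul_left_comm, Nat.mul_div_cancel' hmn, Nat.cast_mul, ZMod.natCast_self,
      mul_zero]
  rw [cycleChar, h, AddChar.map_zero_eq_one]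

/-- Points at cyclic distance at least `L` modulo the period `l` have well separated characters. -/
lemma le_norm_cycleChar_sub {l L a b : ℕ} (hnl : n = m * l) (hab : a + L ≤ b) (hb : b + L ≤ a + l) :
    4 * L / (l : ℝ) ≤ ‖cycleChar n m (b : ZMod n) - cycleChar n m (a : ZMod n)‖ := by
  have hn : n ≠ 0 := NeZero.ne n
  have hm : (m : ℝ) ≠ 0 := by rintro h; simp_all
  have hl : (0 : ℝ) < l := by
    rcases Nat.eq_zero_or_pos l with h | h
    · simp_all
    · exact_mod_cast h
  obtain ⟨t, rfl⟩ : ∃ t, b = a + t := ⟨b - a, by omega⟩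
  have h1 : cycleChar n m ((a + t : ℕ) : ZMod n) - cycleChar n m (a : ZMod n) =
      cycleChar n m (a : ZMod n) * (cycleChar n m ((t : ℤ) : ZMod n) - 1) := by
    push_cast
    rw [cycleChar_add]; ring
  rw [h1, norm_mul, norm_cycleChar, one_mul, cycleChar_intCast,
    Complex.norm_exp_I_mul_ofReal_sub_one]
  have harg : 2 * Real.pi * m / n * ((t : ℤ) : ℝ) / 2 = Real.pi * (t / l) := by
    rw [hnl]; push_cast; field_simp
  rw [harg]
  have ht1 : (L : ℝ) ≤ t := by exact_mod_cast (by omega : L ≤ t)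
  have ht2 : (t : ℝ) + L ≤ l := by exact_mod_cast (by omega : t + L ≤ l)
  have hL : (0 : ℝ) ≤ L := by positivity
  have hpi := Real.pi_pos
  -- Jordan's inequality; the other half of the period follows by the symmetry of the sine about `π
  -- / 2`.
  have hsin : ∀ s : ℝ, 0 ≤ s → s ≤ 1 / 2 → 2 * s ≤ Real.sin (Real.pi * s) := by
    intro s hs0 hs1
    have := Real.mul_le_sin (x := Real.pi * s) (by positivity) (by nlinarith)
    rwa [← mul_assoc, div_mul_cancel₀ _ hpi.ne'] at this
  have key : 2 * (L / l : ℝ) ≤ Real.sin (Real.pi * (t / l)) := by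
    rcases le_total ((t : ℝ) / l) (1 / 2) with h | h
    · refine le_trans ?_ (hsin _ (by positivity) h)
      gcongr
    · have h2 := hsin (1 - t / l) (sub_nonneg.2 ((div_le_one hl).2 (by linarith))) (by linarith)
      rw [mul_sub Real.pi, mul_one, Real.sin_pi_sub] at h2
      refine le_trans ?_ h2
      have : (L / l : ℝ) ≤ 1 - t / l := by
        rw [le_sub_iff_add_le, ← add_div, div_le_one hl]; linarith
      linarith
  rw [Real.norm_eq_abs]
  calc 4 * L / (l : ℝ) = 2 * (2 * (L / l : ℝ)) := by ring
    _ ≤ 2 * Real.sin (Real.pi * (t / l)) := by linarith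
    _ ≤ _ := le_abs_self _

/-- A long range step leaves the character unchanged, so it acts like staying put and cancels the
mass subtracted from the holding probability. -/
lemma sum_homogeneousMatrix_mul_cycleChar (hmn : m ∣ n) (G : SimpleGraph (ZMod n))
    (hG : ∀ x y, G.Adj x y → x ∈ equidistantNodes n m ∧ y ∈ equidistantNodes n m)
    (qc ql r d : ℝ) (x : ZMod n) :
    ∑ y, (homogeneousMatrix G qc ql r d x y : ℂ) * cycleChar n m y =
      cycleEigenvalue n m qc r * cycleChar n m x := by
  classical
  have hadj : ∑ y, ((if G.Adj x y then ql / d else 0 : ℝ) : ℂ) * cycleChar n m y =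
      ((∑ y, if G.Adj x y then ql / d else 0 : ℝ) : ℂ) * cycleChar n m x := by
    rw [Complex.ofReal_sum, sum_mul]
    refine sum_congr rfl fun y _ => ?_
    split_ifs with h
    · rw [cycleChar_eq_one_of_mem hmn (hG x y h).1, cycleChar_eq_one_of_mem hmn (hG x y h).2]
    · simp
  have hpick : ∀ (z : ZMod n) (c : ℝ),
      ∑ y, ((if y = z then c else 0 : ℝ) : ℂ) * cycleChar n m y = c * cycleChar n m z := by
    intro z c
    rw [sum_eq_single z (by intro b _ hb; simp [hb]) (by simp)]
    simp
  have h1 := cycleChar_intCast (n := n) (m := m) 1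
  have h2 := cycleChar_intCast (n := n) (m := m) (-1)
  rw [Int.cast_one, Int.cast_one, mul_one, mul_comm, Complex.exp_mul_I] at h1
  rw [Int.cast_neg, Int.cast_one, Int.cast_neg, Int.cast_one, mul_neg_one, mul_comm,
    Complex.exp_mul_I] at h2
  simp only [homogeneousMatrix, Complex.ofReal_add, add_mul, sum_add_distrib]
  rw [hpick, hpick, hpick, hadj]
  rw [cycleEigenvalue, sub_eq_add_neg x, cycleChar_add, cycleChar_add, h1, h2]
  push_cast
  rw [Complex.cos_neg, Complex.sin_neg]
  ring

/-- At a node without long range edges the holding probability is exactly `1 - 2 * qc`; `1 < n`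
keeps both neighbours distinct from the node. -/
lemma two_mul_le_one_of_rowStochastic (hn : 1 < n) {G : SimpleGraph (ZMod n)} {x : ZMod n}
    (hx : ∀ y, ¬ G.Adj x y) {qc ql r d : ℝ}
    (hP : homogeneousMatrix G qc ql r d ∈ Matrix.rowStochastic ℝ (ZMod n)) : 2 * qc ≤ 1 := by
  have h := (Matrix.mem_rowStochastic_iff_sum.1 hP).1 x x
  have : Fact (1 < n) := ⟨hn⟩
  have h1 : x ≠ x + 1 := by simp
  have h2 : x ≠ x - 1 := by
    intro h; rw [eq_sub_iff_add_eq] at h; exact h1 h.symm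
  simp [homogeneousMatrix, hx, h2] at h
  linarith

end cycleChar

/-- The drift `r` enters only the imaginary part, which can only increase the modulus. With angle
`θ`, the real part is at least `1 - θ ^ 2 / 2`. -/
lemma one_sub_sq_le_norm_cycleEigenvalue_sq {n m : ℕ} {qc : ℝ} (hqc : 2 * qc ≤ 1) (r : ℝ) :
    1 - (2 * Real.pi * m / n) ^ 2 ≤ ‖cycleEigenvalue n m qc r‖ ^ 2 := by
  rw [Complex.sq_norm, cycleEigenvalue, Complex.normSq_add_mul_I]
  have h1 := Real.one_sub_sq_div_two_le_cos (x := 2 * Real.pi * m / n)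
  have h2 := Real.cos_le_one (2 * Real.pi * m / n)
  nlinarith [sq_nonneg (2 * qc * (1 - Real.cos (2 * Real.pi * m / n))),
    sq_nonneg (2 * r * Real.sin (2 * Real.pi * m / n))]

/-! ### Time scale and conclusion -/

lemma le_mul_period {α : ℝ} (hα : α < 2) {n m l : ℕ} (hn : 0 < n)
    (hm : m = 2 * ⌈(n : ℝ) ^ (2 - α)⌉₊) (hnl : n = m * l) :
    (n : ℝ) ^ (2 * α - 2) ≤ 16 * (l : ℝ) ^ 2 := by
  have hn1 : (1 : ℝ) ≤ n := by exact_mod_cast hn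
  have hn0 : (0 : ℝ) < n := by linarith
  have h1 : (1 : ℝ) ≤ (n : ℝ) ^ (2 - α) := Real.one_le_rpow hn1 (by linarith)
  -- Since `n ^ (2 - α) ≥ 1`, the ceiling at most doubles it.
  have hm4 : (m : ℝ) ≤ 4 * (n : ℝ) ^ (2 - α) := by
    have := Nat.ceil_lt_add_one (a := (n : ℝ) ^ (2 - α)) (by linarith)
    rw [hm]; push_cast; linarith
  have h2 : (n : ℝ) ^ (α - 1) ≤ 4 * l := by
    have h3 : (n : ℝ) ≤ 4 * (n : ℝ) ^ (2 - α) * l := by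
      calc (n : ℝ) = m * l := by exact_mod_cast hnl
        _ ≤ _ := by gcongr
    have h4 : (n : ℝ) ^ (α - 1) * (n : ℝ) ^ (2 - α) = n := by
      rw [← Real.rpow_add hn0, show α - 1 + (2 - α) = 1 by ring, Real.rpow_one]
    refine le_of_mul_le_mul_right ?_ (lt_of_lt_of_le one_pos h1)
    rw [h4]; linarith
  calc (n : ℝ) ^ (2 * α - 2) = ((n : ℝ) ^ (α - 1)) ^ 2 := by
        rw [← Real.rpow_natCast, ← Real.rpow_mul hn0.le]; norm_num; ring_nf
    _ ≤ (4 * l) ^ 2 := by gcongr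
    _ = _ := by ring

/-- For a period `l ≥ J`, the chain is unmixed up to a time of order `l ^ 2`. -/
lemma exists_lt_tvDist_homogeneousMatrix {ε : ℝ} {J : ℕ} (hJ2 : 2 ≤ J)
    (hJ : 2 / (J : ℝ) < 1 - ε) (hε : 0 < ε)
    {n m l : ℕ} [NeZero n] (hnl : n = m * l) (hl : J ≤ l) {G : SimpleGraph (ZMod n)}
    (hG : ∀ x y, G.Adj x y → x ∈ equidistantNodes n m ∧ y ∈ equidistantNodes n m)
    {qc ql r d : ℝ} (hP : homogeneousMatrix G qc ql r d ∈ Matrix.rowStochastic ℝ (ZMod n))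
    {π : ZMod n → ℝ} (hπ : π ∈ stdSimplex ℝ (ZMod n)) {k : ℕ}
    (hk : (k : ℝ) * (32 * Real.pi ^ 2 * J ^ 2) ≤ (1 - ε) * l ^ 2) :
    ∃ σ ∈ stdSimplex ℝ (ZMod n), ε < tvDist (σ ᵥ* homogeneousMatrix G qc ql r d ^ k) π := by
  have hmn : m ∣ n := ⟨l, hnl⟩
  have hm : 0 < m := by
    rcases Nat.eq_zero_or_pos m with h | h
    · exact absurd (by simp [hnl, h]) (NeZero.ne n)
    · exact h
  have hmR : (0 : ℝ) < m := by exact_mod_cast hm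
  have hlR : (0 : ℝ) < l := by exact_mod_cast (by omega : 0 < l)
  have hJR : (2 : ℝ) ≤ J := by exact_mod_cast hJ2
  -- As `l ≥ 2`, node 1 carries no long range edge, which gives `2 * qc ≤ 1`.
  have hone : (1 : ZMod n) ∉ equidistantNodes n m := by
    intro h
    have h1 := le_norm_cycleChar_sub (L := 1) (a := 0) (b := 1) hnl (by omega) (by omega)
    rw [Nat.cast_one, Nat.cast_one, cycleChar_eq_one_of_mem hmn h] at h1
    have h2 : cycleChar n m ((0 : ℕ) : ZMod n) = 1 := by simp [cycleChar]
    rw [h2, sub_self, norm_zero] at h1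
    have : 0 < 4 * 1 / (l : ℝ) := by positivity
    linarith
  have hqc := two_mul_le_one_of_rowStochastic (by nlinarith) (fun y h => hone (hG 1 y h).1) hP
  have hθ : 2 * Real.pi * m / n = 2 * Real.pi / l := by
    rw [hnl]; push_cast; field_simp
  have hz := one_sub_sq_le_norm_cycleEigenvalue_sq (n := n) (m := m) hqc r
  rw [hθ] at hz
  set δ : ℝ := k * (2 * Real.pi / l) ^ 2 with hδ
  -- Chebyshev's error `4 * J ^ 2 * δ` and the mass `1 / J` each take at most half of `1 - ε`.
  have hδ' : 8 * J ^ 2 * δ ≤ 1 - ε := by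
    have : 8 * J ^ 2 * δ = k * (32 * Real.pi ^ 2 * J ^ 2) / l ^ 2 := by
      rw [hδ]; field_simp; ring
    rw [this, div_le_iff₀ (by positivity)]
    exact hk
  have hδ0 : 0 ≤ δ := by positivity
  have hL1 : 1 ≤ l / J := (Nat.one_le_div_iff (by omega)).2 hl
  have hL2 : J * (l / J) ≤ l := Nat.mul_div_le l J
  -- Rounding `l / J` down loses at most a factor 2 because `J ≤ l`.
  have hL3 : (l : ℝ) ≤ 2 * J * ((l / J : ℕ) : ℝ) := by
    have h1 := Nat.lt_mul_div_succ l (by omega : 0 < J)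
    have h2 : l ≤ 2 * J * (l / J) := by nlinarith
    exact_mod_cast h2
  have hsep : ∀ i j, i < j → j < J → 2 / (J : ℝ) ≤
      ‖cycleChar n m ((j * (l / J) : ℕ) : ZMod n) - cycleChar n m ((i * (l / J) : ℕ) : ZMod n)‖ := by
    intro i j hij hj
    refine le_trans ?_ (le_norm_cycleChar_sub (L := l / J) hnl ?_ ?_)
    · rw [div_le_div_iff₀ (by positivity) hlR]
      linarith
    · calc i * (l / J) + l / J = (i + 1) * (l / J) := by ring
        _ ≤ _ := Nat.mul_le_mul_right _ hij
    · calc j * (l / J) + l / J = (j + 1) * (l / J) := by ring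
        _ ≤ J * (l / J) := Nat.mul_le_mul_right _ hj
        _ ≤ _ := by omega
  refine exists_lt_tvDist_of_eigenfunction hP hπ norm_cycleChar
    (sum_homogeneousMatrix_mul_cycleChar hmn G hG qc ql r d) (J := J) (by omega)
    (fun j => ((j * (l / J) : ℕ) : ZMod n)) ?_ (δ := δ) ?_ ?_ ?_
  · intro i hi j hj hij
    rcases lt_or_gt_of_ne hij with h | h
    · rw [norm_sub_rev]; exact hsep i j h hj
    · exact hsep j i h hi
  · rw [pow_mul]
    -- Bernoulli's inequality gives `‖z‖ ^ (2 * k) ≥ 1 - δ`.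
    have hb := one_add_mul_le_pow (a := ‖cycleEigenvalue n m qc r‖ ^ 2 - 1)
      (by linarith [sq_nonneg ‖cycleEigenvalue n m qc r‖]) k
    rw [add_sub_cancel] at hb
    refine le_trans ?_ hb
    have : (k : ℝ) * (-(2 * Real.pi / l) ^ 2) ≤ k * (‖cycleEigenvalue n m qc r‖ ^ 2 - 1) :=
      mul_le_mul_of_nonneg_left (by linarith) (by positivity)
    rw [hδ]; linarith
  · nlinarith
  · have : 2 / (J : ℝ) = 1 / J + 1 / J := by ring
    linarith

theorem mainTheorem9 (ε : ℝ) (hε0 : 0 < ε) (hε1 : ε < 1) :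
    ∃ c : ℝ, 0 < c ∧
      ∀ (α : ℝ), 1 < α → α < 2 →
      ∀ (n : ℕ) [NeZero n], 1 < (1 - ε) * (n : ℝ) →
      -- the number of endpoints divides `n`, so they can be placed exactly equidistantly
      ∀ (m : ℕ), m = 2 * ⌈(n : ℝ) ^ (2 - α)⌉₊ → m ∣ n →
      -- the long range edges form a matching on the equidistant nodes
      ∀ (M : (⊤ : SimpleGraph (ZMod n)).Subgraph), M.IsMatching →
        M.verts ⊆ equidistantNodes n m →
      -- any parameters for which the homogeneous chain is a proper Markov chain
      ∀ (qc ql r d : ℝ), 0 < d →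
        homogeneousMatrix M.spanningCoe qc ql r d ∈ Matrix.rowStochastic ℝ (ZMod n) →
      -- with a unique stationary distribution `π`
      ∀ (π : ZMod n → ℝ), IsStationaryDist (homogeneousMatrix M.spanningCoe qc ql r d) π →
        (∀ π' : ZMod n → ℝ,
          IsStationaryDist (homogeneousMatrix M.spanningCoe qc ql r d) π' → π' = π) →
        ENNReal.ofReal (c * (n : ℝ) ^ (2 * α - 2)) ≤
          ((mixingTime (homogeneousMatrix M.spanningCoe qc ql r d) π ε : ℕ∞) : ℝ≥0∞) := by
  obtain ⟨J, hJ⟩ := exists_nat_gt (2 / (1 - ε))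
  have hε' : 0 < 1 - ε := by linarith
  have hJ2R : (2 : ℝ) < J := lt_of_le_of_lt ((le_div_iff₀ hε').2 (by linarith)) hJ
  have hJ2 : 2 ≤ J := by exact_mod_cast hJ2R.le
  have hJ' : 2 / (J : ℝ) < 1 - ε := by rwa [div_lt_comm₀ (by linarith) hε']
  have hpi : 1 ≤ Real.pi ^ 2 := by nlinarith [Real.pi_gt_three]
  set D : ℝ := 32 * Real.pi ^ 2 * J ^ 2 with hD
  have hD0 : 0 < D := by positivity
  refine ⟨(1 - ε) / (16 * D), by positivity, ?_⟩
  intro α _ hα n _ hn m hm hmn M _ hMv qc ql r d _ hP π hπ _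
  obtain ⟨l, hnl⟩ := hmn
  have hT := le_mul_period hα (NeZero.pos n) hm hnl
  have hG : ∀ x y, M.spanningCoe.Adj x y →
      x ∈ equidistantNodes n m ∧ y ∈ equidistantNodes n m := fun x y h =>
    ⟨hMv (M.edge_vert h), hMv (M.edge_vert h.symm)⟩
  refine ofReal_le_mixingTime hP hπ.2 fun k hk => ?_
  have hkD : (k : ℝ) * D < (1 - ε) * l ^ 2 := by
    calc (k : ℝ) * D < (1 - ε) / (16 * D) * (n : ℝ) ^ (2 * α - 2) * D := by gcongr
      _ ≤ (1 - ε) / (16 * D) * (16 * (l : ℝ) ^ 2) * D := by gcongr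
      _ = _ := by field_simp
  rcases le_or_gt J l with hl | hl
  · exact exists_lt_tvDist_homogeneousMatrix hJ2 hJ' hε0 hnl hl hG hP hπ.1 hkD.le
  -- For `l < J`, a time `k ≥ 1` would give `D ≤ k * D < l ^ 2 ≤ J ^ 2 ≤ D`. At time 0 a point mass
  -- is unmixed because `(1 - ε) * n > 1`.
  · have hk0 : k = 0 := by
      by_contra h
      have hk1 : (1 : ℝ) ≤ k := by exact_mod_cast Nat.one_le_iff_ne_zero.2 h
      have hlJ : (l : ℝ) ^ 2 ≤ J ^ 2 := by gcongr
      have h1 : D ≤ k * D := le_mul_of_one_le_left hD0.le hk1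
      nlinarith [sq_nonneg (l : ℝ), sq_nonneg (J : ℝ)]
    subst hk0
    simp only [pow_zero, Matrix.vecMul_one]
    exact exists_lt_tvDist_single hπ.1 (by rwa [ZMod.card])
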